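/- For a semigroup $S$ let $\ell^1(S)$ be the complex Banach algebra of absolutely summable families $a=\sum_{s\in S}a_s\delta_s$ with the convolution product determined by $\delta_s\delta_t=\delta_{st}$, and identify $\ell^1(S)^*$ with $\ell^\infty(S)$ through $\langle x,a\rangle=\sum_{s}x_sa_s$. A \emph{predual} of $\ell^1(S)$ is a norm-closed subspace $E\subseteq\ell^\infty(S)$ which is an $\ell^1(S)$-submodule (for $x\in E$ and $a\in\ell^1(S)$ the functionals $b\mapsto\langle x,ba\rangle$ and $b\mapsto\langle x,ab\rangle$ belong to $E$), and for which the canonical map $\ell^1(S)\to E^*$, $a\mapsto(x\mapsto\langle x,a\rangle)$, is an isomorphism of Banach spaces (not necessarily isometric). A predual $E$ is a \emph{Hopf algebra predual} if the coproduct $\Gamma:\ell^1(S)\to\ell^1(S\times S)$, $\Gamma(\delta_s)=\delta_{(s,s)}$, is weak$^*$-continuous, that is, continuous from the topology $\sigma(\ell^1(S),E)$ to $\sigma(\ell^1(S\times S),E\check\otimes E)$, where $E\check\otimes E\subseteq\ell^\infty(S\times S)$ is the closed linear span of the functions $(s,t)\mapsto x_sy_t$ with $x,y\in E$ (equivalently,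 if $E$ is a subalgebra of $\ell^\infty(S)$ for the pointwise product). Let $k\ge1$, and let $S$ be either the additive semigroup $\mathbb Z_+^k$, where $\mathbb Z_+=\{0,1,2,\dots\}$, or the free semigroup on $k$ generators (non-empty words under concatenation). Then $c_0(S)$, the space of functions on $S$ that tend to zero at infinity, is a Hopf algebra predual of $\ell^1(S)$, and it is the only one: every Hopf algebra predual $E\subseteq\ell^\infty(S)$ of $\ell^1(S)$ equals $c_0(S)$. -/

import Mathlib

open scoped ENNReal Topology

/-- The Banach space `ℓ¹(S)` of absolutely summable complex families on `S`. -/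
noncomputable abbrev EllOne (S : Type*) := lp (fun _ : S => ℂ) 1

/-- The Banach algebra `ℓ^∞(S)` of bounded complex families on `S`, with pointwise product. -/
noncomputable abbrev EllInfty (S : Type*) := lp (fun _ : S => ℂ) ∞

theorem ellOne_summable_norm {S : Type*} (a : EllOne S) : Summable fun s => ‖a s‖ := by
  simpa using (lp.memℓp a).summable (by simp)

theorem memEllOne_of_summable_norm {S : Type*} {f : S → ℂ} (hf : Summable fun s => ‖f s‖) :
    Memℓp f 1 :=
  memℓp_gen (by simpa using hf)

/-- The duality `⟨x, a⟩ = ∑ₛ xₛ aₛ` which identifies `ℓ^∞(S)` with the dual space of `ℓ¹(S)`. -/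
noncomputable def ellPairing (S : Type*) : EllInfty S →L[ℂ] EllOne S →L[ℂ] ℂ :=
  lp.dualPairing ∞ 1 (fun _ : S => ContinuousLinearMap.mul ℂ ℂ) (K := 1)
    (fun _ => by simp)

theorem ellPairing_apply {S : Type*} (x : EllInfty S) (a : EllOne S) :
    ellPairing S x a = ∑' s, x s * a s := rfl

theorem summable_norm_mul_prod {S : Type*} (a b : EllOne S) :
    Summable fun p : S × S => ‖a p.1 * b p.2‖ := by
  simpa [norm_mul] using (ellOne_summable_norm a).mul_of_nonneg (ellOne_summable_norm b)
    (fun _ => norm_nonneg _) (fun _ => norm_nonneg _)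

/-- The convolution product of `ℓ¹(S)`: `(a * b)ₛ = ∑_{tr = s} aₜ bᵣ`, so that
`δₜ * δᵣ = δ_{tr}`. -/
noncomputable def ellConv {S : Type*} [Mul S] (a b : EllOne S) : EllOne S :=
  ⟨fun s => ∑' p : {p : S × S // p.1 * p.2 = s}, a p.1.1 * b p.1.2, by
    have h := summable_norm_mul_prod a b
    have h' := (Equiv.sigmaFiberEquiv fun p : S × S => p.1 * p.2).summable_iff.mpr h
    refine memEllOne_of_summable_norm (Summable.of_nonneg_of_le (fun _ => norm_nonneg _)
      (fun s => norm_tsum_le_tsum_norm ?_) h'.sigma)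
    exact h'.sigma_factor s⟩

/-- The coproduct `Γ : ℓ¹(S) → ℓ¹(S × S)`, the bounded linear map with `Γ(δₛ) = δ_{(s,s)}`:
`Γ(a)` is `aₛ` at `(s, s)`, and vanishes off the diagonal. -/
noncomputable def ellCoproduct {S : Type*} (a : EllOne S) : EllOne (S × S) :=
  ⟨open Classical in fun p => if p.1 = p.2 then a p.1 else 0, by
    classical
    have hi : Function.Injective fun s : S => (s, s) := fun s t h => congrArg Prod.fst h
    refine memEllOne_of_summable_norm ((hi.summable_iff ?_).mp ?_)
    · rintro ⟨s, t⟩ h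
      have : s ≠ t := fun e => h ⟨s, by simp [e]⟩
      simp [this]
    · simpa [Function.comp_def] using ellOne_summable_norm a⟩

/-- The elementary tensor `x ⊗ y ∈ ℓ^∞(S × S)`, that is, `(s, t) ↦ xₛ yₜ`. -/
noncomputable def ellTensor {S : Type*} (x y : EllInfty S) : EllInfty (S × S) :=
  ⟨fun p => x p.1 * y p.2, memℓp_infty ⟨‖x‖ * ‖y‖, by
    rintro _ ⟨p, rfl⟩
    simp only [norm_mul]
    exact mul_le_mul (lp.norm_apply_le_norm (by simp) x _) (lp.norm_apply_le_norm (by simp) y _)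
      (norm_nonneg _) (norm_nonneg _)⟩⟩

/-- The closed linear span of `{x ⊗ y : x, y ∈ E}` in `ℓ^∞(S × S)`: the (injective) tensor square
of `E`, which induces the weak* topology of `ℓ¹(S × S)` that belongs to `E`. -/
noncomputable def ellTensorSquare {S : Type*} (E : Submodule ℂ (EllInfty S)) :
    Submodule ℂ (EllInfty (S × S)) :=
  (Submodule.span ℂ {z | ∃ x ∈ E, ∃ y ∈ E, z = ellTensor x y}).topologicalClosure

/-- The weak* topology `σ(ℓ¹(S), E)`: the coarsest topology on `ℓ¹(S)` for which `a ↦ ⟨x, a⟩` is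
continuous for every `x ∈ E`. -/
@[reducible]
noncomputable def ellWeakStar {S : Type*} (E : Submodule ℂ (EllInfty S)) :
    TopologicalSpace (EllOne S) :=
  TopologicalSpace.induced (fun (a : EllOne S) (x : E) => ellPairing S x a) inferInstance

/-- A predual of the convolution algebra `ℓ¹(S)`: a closed subspace `E` of `ℓ^∞(S) = ℓ¹(S)*` which
is a submodule for the actions `⟨a · x, b⟩ = ⟨x, b * a⟩` and `⟨x · a, b⟩ = ⟨x, a * b⟩` of `ℓ¹(S)`,
and for which the canonical map `ℓ¹(S) → E*` is an isomorphism of Banach spaces (not necessarily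
an isometry). -/
structure IsEllOnePredual {S : Type*} [Mul S] (E : Submodule ℂ (EllInfty S)) : Prop where
  isClosed : IsClosed (E : Set (EllInfty S))
  left_mem : ∀ (a : EllOne S), ∀ x ∈ E, ∃ y ∈ E, ∀ b : EllOne S,
    ellPairing S y b = ellPairing S x (ellConv b a)
  right_mem : ∀ (a : EllOne S), ∀ x ∈ E, ∃ y ∈ E, ∀ b : EllOne S,
    ellPairing S y b = ellPairing S x (ellConv a b)
  exists_equiv : ∃ e : EllOne S ≃L[ℂ] StrongDual ℂ E, ∀ (a : EllOne S) (x : E),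
    e a x = ellPairing S (x : EllInfty S) a

/-- A Hopf algebra predual of `ℓ¹(S)`: a predual for which the coproduct is weak*-continuous. -/
structure IsHopfAlgebraPredual {S : Type*} [Mul S] (E : Submodule ℂ (EllInfty S)) : Prop
    extends IsEllOnePredual E where
  continuous_coproduct :
    Continuous[ellWeakStar E, ellWeakStar (ellTensorSquare E)] (ellCoproduct (S := S))

/-- The space `c₀(S)` of families that tend to zero at infinity on the discrete set `S`, as a
subspace of `ℓ^∞(S)`. -/
def cZero (S : Type*) : Submodule ℂ (EllInfty S) where
  carrier := {x | Filter.Tendsto (fun s => x s) Filter.cofinite (𝓝 0)}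
  zero_mem' := tendsto_const_nhds
  add_mem' {x y} hx hy := by
    have := Filter.Tendsto.add hx hy
    rwa [add_zero] at this
  smul_mem' c x hx := by
    have := Filter.Tendsto.const_mul c hx
    rwa [mul_zero] at this

/-!
Let `E` be a Hopf algebra predual of `ℓ¹(S)`. A functional on `ℓ¹(S)` which is weak*-continuous is
given by an element of `E`, so weak*-continuity of the coproduct makes `E` a subalgebra of
`ℓ^∞(S)` (`IsHopfAlgebraPredual.ellDiag_ellTensor_mem`). Along an ultrafilter on `S` the point
evaluations converge weak* to a multiplicative functional on `E`, which is given by some `a ∈ ℓ¹(S)`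
because `E* = ℓ¹(S)`. Multiplicativity means that `y a = ⟨y, a⟩ a` for all `y ∈ E`, so that `a` acts
on `E` as zero or as a point mass (`IsHopfAlgebraPredual.tendsto_zero_or_exists_tendsto`). In other
words, `E` makes `S` a locally compact space whose point at infinity is the zero functional.

As `E` is a submodule, left translations extend continuously to this compactification and fix the
point at infinity, hence each `uS` is closed in `S` (`IsHopfAlgebraPredual.mem_range_mul_of_tendsto`).
In `ℤ₊ᵏ` and in free semigroups of finite rank each point lies in a finite set whose complement is a
finite union of sets `uS`, so the topology is discrete and `E ⊆ c₀(S)`. An inclusion of preduals is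
an equality, by Hahn–Banach and `c₀(S)* = ℓ¹(S)` (`IsEllOnePredual.eq_cZero_of_le`).

That `c₀(S)` is itself a Hopf algebra predual uses only that `S` is cancellative
(`isHopfAlgebraPredual_cZero`): translates of null functions are then null functions.
-/

variable {S : Type*}

/-! ### Point masses and the pairing -/

open Classical in
/-- The point mass `δₛ ∈ ℓ¹(S)`. -/
noncomputable def ellDelta (s : S) : EllOne S := lp.single 1 s 1

open Classical in
/-- The indicator function of `{s}`, as an element of `ℓ^∞(S)`. -/
noncomputable def ellPoint (s : S) : EllInfty S := lp.single ∞ s 1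

theorem ellDelta_apply_self (s : S) : ellDelta s s = 1 := by
  simp [ellDelta]

theorem ellDelta_apply_of_ne {s t : S} (h : t ≠ s) : ellDelta s t = 0 := by
  simp [ellDelta, h]

theorem norm_ellDelta (s : S) : ‖ellDelta s‖ = 1 := by
  simp [ellDelta]

theorem ellPoint_apply_self (s : S) : ellPoint s s = 1 := by
  simp [ellPoint]

theorem ellPoint_apply_of_ne {s t : S} (h : t ≠ s) : ellPoint s t = 0 := by
  simp [ellPoint, h]

theorem ellInfty_norm_apply_le (x : EllInfty S) (s : S) : ‖x s‖ ≤ ‖x‖ :=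
  lp.norm_apply_le_norm (by simp) x s

theorem ellPairing_ellDelta (x : EllInfty S) (s : S) : ellPairing S x (ellDelta s) = x s := by
  rw [ellPairing_apply, tsum_eq_single s fun t ht => by rw [ellDelta_apply_of_ne ht, mul_zero],
    ellDelta_apply_self, mul_one]

theorem ellPairing_ellPoint (s : S) (a : EllOne S) : ellPairing S (ellPoint s) a = a s := by
  rw [ellPairing_apply, tsum_eq_single s fun t ht => by rw [ellPoint_apply_of_ne ht, zero_mul],
    ellPoint_apply_self, one_mul]

theorem summable_norm_ellInfty_mul (x : EllInfty S) (a : EllOne S) :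
    Summable fun s => ‖x s * a s‖ := by
  refine Summable.of_nonneg_of_le (fun _ => norm_nonneg _) (fun s => ?_)
    ((ellOne_summable_norm a).mul_left ‖x‖)
  rw [norm_mul]
  exact mul_le_mul_of_nonneg_right (ellInfty_norm_apply_le x s) (norm_nonneg _)

/-! ### The pairing with a convolution product -/

theorem summable_mul_conv (m : S → S → S) (x : EllInfty S) (a b : EllOne S) :
    Summable fun p : S × S => x (m p.1 p.2) * (a p.1 * b p.2) := by
  refine Summable.of_norm_bounded ((summable_norm_mul_prod a b).mul_left ‖x‖) fun p => ?_
  rw [norm_mul]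
  exact mul_le_mul_of_nonneg_right (ellInfty_norm_apply_le x _) (norm_nonneg _)

theorem ellPairing_ellConv [Mul S] (x : EllInfty S) (a b : EllOne S) :
    ellPairing S x (ellConv a b) = ∑' p : S × S, x (p.1 * p.2) * (a p.1 * b p.2) := by
  have h := (Equiv.sigmaFiberEquiv fun p : S × S => p.1 * p.2).summable_iff.mpr
    (summable_mul_conv (· * ·) x a b)
  rw [← (Equiv.sigmaFiberEquiv fun p : S × S => p.1 * p.2).tsum_eq, ellPairing_apply]
  refine Eq.trans (tsum_congr fun s => ?_) h.tsum_sigma.symm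
  change x s * ∑' p : {p : S × S // p.1 * p.2 = s}, a p.1.1 * b p.1.2 = _
  rw [← tsum_mul_left]
  refine tsum_congr fun p => ?_
  simp [p.2]

theorem ellPairing_ellConv_ellDelta [Mul S] (x : EllInfty S) (u s : S) :
    ellPairing S x (ellConv (ellDelta u) (ellDelta s)) = x (u * s) := by
  rw [ellPairing_ellConv, tsum_eq_single (u, s)]
  · simp [ellDelta_apply_self]
  · rintro ⟨p, q⟩ h
    by_cases hp : p = u
    · have hq : q ≠ s := fun hq => h (by rw [hp, hq])
      simp [ellDelta_apply_of_ne hq]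
    · simp [ellDelta_apply_of_ne hp]

/-- The function `s ↦ ∑ₜ x_{m(s, t)} aₜ`. For `m s t = s * t` and `m s t = t * s` these are the two
actions of `a ∈ ℓ¹(S)` on `x ∈ ℓ^∞(S)`. -/
noncomputable def ellAct (m : S → S → S) (x : EllInfty S) (a : EllOne S) : EllInfty S :=
  ⟨fun s => ∑' t, x (m s t) * a t, memℓp_infty ⟨∑' t, ‖x‖ * ‖a t‖, by
    rintro _ ⟨s, rfl⟩
    refine tsum_of_norm_bounded ((ellOne_summable_norm a).mul_left ‖x‖).hasSum fun t => ?_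
    rw [norm_mul]
    exact mul_le_mul_of_nonneg_right (ellInfty_norm_apply_le x _) (norm_nonneg _)⟩⟩

theorem ellAct_apply (m : S → S → S) (x : EllInfty S) (a : EllOne S) (s : S) :
    ellAct m x a s = ∑' t, x (m s t) * a t := rfl

theorem ellPairing_ellAct (m : S → S → S) (x : EllInfty S) (a b : EllOne S) :
    ellPairing S (ellAct m x a) b = ∑' p : S × S, x (m p.1 p.2) * (b p.1 * a p.2) := by
  rw [(summable_mul_conv m x b a).tsum_prod, ellPairing_apply]
  refine tsum_congr fun s => ?_
  rw [ellAct_apply, ← tsum_mul_right]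
  exact tsum_congr fun t => by ring

/-! ### The space `c₀(S)` and its dual -/

theorem mem_cZero {x : EllInfty S} :
    x ∈ cZero S ↔ Filter.Tendsto (fun s => x s) Filter.cofinite (𝓝 0) := Iff.rfl

theorem isClosed_cZero : IsClosed (cZero S : Set (EllInfty S)) := by
  refine isClosed_of_closure_subset fun x hx => Metric.tendsto_nhds.mpr fun ε hε => ?_
  obtain ⟨y, hy, hxy⟩ := Metric.mem_closure_iff.mp hx (ε / 2) (half_pos hε)
  filter_upwards [Metric.tendsto_nhds.mp (mem_cZero.mp hy) (ε / 2) (half_pos hε)] with s hs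
  have h : dist (x s) (y s) < ε / 2 := by
    rw [dist_eq_norm] at hxy ⊢
    exact (ellInfty_norm_apply_le (x - y) s).trans_lt hxy
  linarith [dist_triangle (x s) (y s) 0]

theorem ellPoint_mem_cZero (s : S) : ellPoint s ∈ cZero S := by
  refine mem_cZero.mpr (tendsto_const_nhds.congr' ?_)
  filter_upwards [(Set.finite_singleton s).compl_mem_cofinite] with t ht
  exact (ellPoint_apply_of_ne ht).symm

theorem ellAct_mem_cZero {m : S → S → S} (hm : ∀ t, Function.Injective fun s => m s t)
    {x : EllInfty S} (hx : x ∈ cZero S) (a : EllOne S) : ellAct m x a ∈ cZero S := by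
  have h : Filter.Tendsto (fun s => ∑' t, x (m s t) * a t) Filter.cofinite
      (𝓝 (∑' _ : S, (0 : ℂ))) := by
    refine tendsto_tsum_of_dominated_convergence ((ellOne_summable_norm a).mul_left ‖x‖)
      (fun t => ?_) (Filter.Eventually.of_forall fun s t => ?_)
    · simpa using ((mem_cZero.mp hx).comp (hm t).tendsto_cofinite).mul_const (a t)
    · rw [norm_mul]
      exact mul_le_mul_of_nonneg_right (ellInfty_norm_apply_le x _) (norm_nonneg _)
  simpa [mem_cZero, ellAct_apply] using h

/-- Finitely supported functions are dense in `c₀(S)`. -/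
theorem hasSum_ellPoint_of_mem_cZero {x : EllInfty S} (hx : x ∈ cZero S) :
    HasSum (fun s => x s • ellPoint s) x := by
  classical
  rw [HasSum, SummationFilter.unconditional_filter, Metric.tendsto_atTop]
  intro ε hε
  have hfin : {s | ¬ ‖x s‖ < ε / 2}.Finite := by
    have := (mem_cZero.mp hx).norm.eventually_lt_const (u := ε / 2) (by simpa using half_pos hε)
    simpa using this
  refine ⟨hfin.toFinset, fun F hF => ?_⟩
  rw [dist_comm, dist_eq_norm]
  refine lt_of_le_of_lt (lp.norm_le_of_forall_le (half_pos hε).le fun t => ?_) (half_lt_self hε)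
  have hsum : (∑ s ∈ F, x s • ellPoint s : EllInfty S) t = if t ∈ F then x t else 0 := by
    rw [lp.coeFn_sum, Finset.sum_apply, ← Finset.sum_ite_eq F t fun s => x s]
    refine Finset.sum_congr rfl fun s _ => ?_
    split_ifs with h
    · subst h; simp [ellPoint_apply_self]
    · simp [ellPoint_apply_of_ne h]
  rw [lp.coeFn_sub, Pi.sub_apply, hsum]
  split_ifs with h
  · simpa using (half_pos hε).le
  · have : t ∉ hfin.toFinset := fun h' => h (hF h')
    simp only [Set.Finite.mem_toFinset, Set.mem_ofPred_eq, not_not] at this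
    simpa using this.le

/-- The values of a bounded functional at the indicators of points are absolutely summable: test the
functional on finite sums of indicators with unimodular coefficients. -/
theorem summable_norm_dual_ellPoint (φ : StrongDual ℂ (cZero S)) :
    Summable fun s => ‖φ ⟨ellPoint s, ellPoint_mem_cZero s⟩‖ := by
  classical
  set c : S → ℂ := fun s => φ ⟨ellPoint s, ellPoint_mem_cZero s⟩ with hc
  refine summable_of_sum_le (c := ‖φ‖) (fun _ => norm_nonneg _) fun F => ?_
  -- `w s` has modulus at most one and satisfies `w s * c s = |c s|`.
  set w : S → ℂ := fun s => (starRingEnd ℂ) (c s) / ‖c s‖ with hw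
  have hwc : ∀ s, w s * c s = (‖c s‖ : ℂ) := fun s => by
    rcases eq_or_ne (c s) 0 with h | h
    · simp [h]
    · have h' : (‖c s‖ : ℂ) ≠ 0 := by simpa using h
      rw [hw]
      field_simp
      rw [mul_comm, Complex.mul_conj']
  have hw1 : ∀ s, ‖w s‖ ≤ 1 := fun s => by
    simp [hw, div_self_le_one]
  set y : cZero S := ∑ s ∈ F, w s • ⟨ellPoint s, ellPoint_mem_cZero s⟩ with hy
  have hyn : ‖y‖ ≤ 1 := by
    rw [Submodule.coe_norm]
    refine lp.norm_le_of_forall_le zero_le_one fun t => ?_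
    have hsum : (y : EllInfty S) t = if t ∈ F then w t else 0 := by
      rw [hy, Submodule.coe_sum, lp.coeFn_sum, Finset.sum_apply,
        ← Finset.sum_ite_eq F t fun s => w s]
      refine Finset.sum_congr rfl fun s _ => ?_
      split_ifs with h
      · subst h; simp [ellPoint_apply_self]
      · simp [ellPoint_apply_of_ne h]
    rw [hsum]
    split_ifs
    · exact hw1 t
    · simp
  have hφy : φ y = ((∑ s ∈ F, ‖c s‖ : ℝ) : ℂ) := by
    have hφ : φ y = ∑ s ∈ F, φ (w s • ⟨ellPoint s, ellPoint_mem_cZero s⟩) := map_sum φ.toLinearMap _ _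
    rw [hφ, Complex.ofReal_sum]
    exact Finset.sum_congr rfl fun s _ => (φ.toLinearMap.map_smul (w s) _).trans (hwc s)
  have h0 : 0 ≤ ∑ s ∈ F, ‖c s‖ := Finset.sum_nonneg fun _ _ => norm_nonneg _
  calc ∑ s ∈ F, ‖c s‖ = ‖φ y‖ := by rw [hφy, Complex.norm_real, Real.norm_of_nonneg h0]
    _ ≤ ‖φ‖ * ‖y‖ := φ.le_opNorm y
    _ ≤ ‖φ‖ := mul_le_of_le_one_right (norm_nonneg φ) hyn

/-- Every bounded functional on `c₀(S)` is the pairing with an element of `ℓ¹(S)`. -/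
theorem exists_ellPairing_eq_of_dual_cZero (φ : StrongDual ℂ (cZero S)) :
    ∃ a : EllOne S, ∀ x : cZero S, ellPairing S x a = φ x := by
  refine ⟨⟨_, memEllOne_of_summable_norm (summable_norm_dual_ellPoint φ)⟩, fun x => ?_⟩
  have hx : HasSum (fun s => (x : EllInfty S) s • (⟨ellPoint s, ellPoint_mem_cZero s⟩ : cZero S))
      x := by
    have hi : Topology.IsInducing (cZero S).subtype := Topology.IsInducing.subtypeVal
    exact (hi.hasSum_iff _ _).mp (hasSum_ellPoint_of_mem_cZero x.2)
  refine Eq.trans (tsum_congr fun s => ?_) (φ.hasSum hx).tsum_eq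
  exact (φ.toLinearMap.map_smul _ _).symm

/-- The canonical map `ℓ¹(S) → E*`. -/
noncomputable def ellToDual (E : Submodule ℂ (EllInfty S)) : EllOne S →L[ℂ] StrongDual ℂ E :=
  ((ellPairing S).comp E.subtypeL).flip

theorem ellToDual_apply (E : Submodule ℂ (EllInfty S)) (a : EllOne S) (x : E) :
    ellToDual E a x = ellPairing S x a := rfl

theorem bijective_ellToDual_cZero : Function.Bijective (ellToDual (cZero S)) := by
  constructor
  · refine (injective_iff_map_eq_zero _).mpr fun a ha => ?_
    ext s
    have := congrArg (fun φ => φ ⟨ellPoint s, ellPoint_mem_cZero s⟩) ha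
    simpa [ellToDual_apply, ellPairing_ellPoint] using this
  · intro φ
    obtain ⟨a, ha⟩ := exists_ellPairing_eq_of_dual_cZero φ
    exact ⟨a, ContinuousLinearMap.ext ha⟩

/-! ### The coproduct -/

/-- The restriction of a bounded function on `S × S` to the diagonal. -/
noncomputable def ellDiag : EllInfty (S × S) →L[ℂ] EllInfty S :=
  LinearMap.mkContinuous
    { toFun := fun z => ⟨fun s => z (s, s), memℓp_infty ⟨‖z‖, by
        rintro _ ⟨s, rfl⟩
        exact ellInfty_norm_apply_le z _⟩⟩
      map_add' := fun _ _ => rfl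
      map_smul' := fun _ _ => rfl } 1 fun z => by
    rw [one_mul]
    exact lp.norm_le_of_forall_le (norm_nonneg _) fun s => ellInfty_norm_apply_le z (s, s)

theorem ellDiag_apply (z : EllInfty (S × S)) (s : S) : ellDiag z s = z (s, s) := rfl

theorem ellPairing_ellCoproduct (z : EllInfty (S × S)) (a : EllOne S) :
    ellPairing (S × S) z (ellCoproduct a) = ellPairing S (ellDiag z) a := by
  classical
  have hi : Function.Injective fun s : S => (s, s) := fun s t h => congrArg Prod.fst h
  rw [ellPairing_apply, ellPairing_apply, ← hi.tsum_eq]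
  · refine tsum_congr fun s => ?_
    simp [ellCoproduct, ellDiag_apply]
  · rintro ⟨s, t⟩ h
    by_contra hst
    have : s ≠ t := fun e => hst ⟨s, by simp [e]⟩
    exact h (by simp [ellCoproduct, this])

theorem continuous_ellWeakStar {E : Submodule ℂ (EllInfty S)} {x : EllInfty S} (hx : x ∈ E) :
    Continuous[ellWeakStar E, inferInstance] fun a : EllOne S => ellPairing S x a :=
  @Continuous.comp (EllOne S) (E → ℂ) ℂ (ellWeakStar E) _ _ _ _
    (continuous_apply (⟨x, hx⟩ : E)) continuous_induced_dom

/-- The coproduct is weak*-continuous if `E` contains the restriction of each `z ∈ E ⊗ E` to the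
diagonal, as that restriction is the image of `z` under the adjoint of the coproduct. -/
theorem continuous_ellCoproduct {E : Submodule ℂ (EllInfty S)}
    (h : ∀ z ∈ ellTensorSquare E, ellDiag z ∈ E) :
    Continuous[ellWeakStar E, ellWeakStar (ellTensorSquare E)] (ellCoproduct (S := S)) := by
  refine continuous_induced_rng.mpr (@continuous_pi _ _ _ (ellWeakStar E) _ _ fun z => ?_)
  simpa only [Function.comp_def, ellPairing_ellCoproduct] using continuous_ellWeakStar (h z z.2)

theorem ellDiag_mem_of_isClosed {E : Submodule ℂ (EllInfty S)} (hE : IsClosed (E : Set (EllInfty S)))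
    (hmul : ∀ x ∈ E, ∀ y ∈ E, ellDiag (ellTensor x y) ∈ E) :
    ∀ z ∈ ellTensorSquare E, ellDiag z ∈ E := by
  have hle : ellTensorSquare E ≤ E.comap (ellDiag (S := S)).toLinearMap := by
    refine Submodule.topologicalClosure_minimal _ (Submodule.span_le.mpr ?_)
      (hE.preimage ellDiag.continuous)
    rintro _ ⟨x, hx, y, hy, rfl⟩
    exact hmul x hx y hy
  exact hle

theorem ellDiag_ellTensor_apply (x y : EllInfty S) (s : S) :
    ellDiag (ellTensor x y) s = x s * y s := rfl

theorem ellDiag_ellTensor_mem_cZero {x y : EllInfty S} (hx : x ∈ cZero S) (hy : y ∈ cZero S) :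
    ellDiag (ellTensor x y) ∈ cZero S := by
  simpa [mem_cZero, ellDiag_ellTensor_apply] using (mem_cZero.mp hx).mul (mem_cZero.mp hy)

/-- The open mapping theorem for a map from a Banach space to a dual space. -/
theorem ContinuousLinearMap.exists_equiv_of_bijective {V X : Type*} [NormedAddCommGroup V]
    [NormedSpace ℂ V] [CompleteSpace V] [NormedAddCommGroup X] [NormedSpace ℂ X]
    (f : V →L[ℂ] StrongDual ℂ X) (hf : Function.Bijective f) :
    ∃ e : V ≃L[ℂ] StrongDual ℂ X, ∀ v, e v = f v :=
  ⟨ContinuousLinearEquiv.ofBijective f (LinearMap.ker_eq_bot.mpr hf.1)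
    (LinearMap.range_eq_top.mpr hf.2), fun _ => rfl⟩

theorem exists_equiv_dual_cZero : ∃ e : EllOne S ≃L[ℂ] StrongDual ℂ (cZero S),
    ∀ (a : EllOne S) (x : cZero S), e a x = ellPairing S (x : EllInfty S) a := by
  obtain ⟨e, he⟩ := (ellToDual (cZero S)).exists_equiv_of_bijective bijective_ellToDual_cZero
  exact ⟨e, fun a x => by rw [he, ellToDual_apply]⟩

/-- If `S` is cancellative, then `c₀(S)` is a Hopf algebra predual. -/
theorem isHopfAlgebraPredual_cZero [Mul S] [IsCancelMul S] :
    IsHopfAlgebraPredual (cZero S) where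
  isClosed := isClosed_cZero
  left_mem a x hx := ⟨ellAct (fun s t => s * t) x a, ellAct_mem_cZero mul_left_injective hx a,
    fun b => by rw [ellPairing_ellAct, ellPairing_ellConv]⟩
  right_mem a x hx := ⟨ellAct (fun s t => t * s) x a, ellAct_mem_cZero mul_right_injective hx a,
    fun b => by
      rw [ellPairing_ellAct, ellPairing_ellConv, ← (Equiv.prodComm S S).tsum_eq]
      exact tsum_congr fun p => by simp [mul_comm (b p.2)]⟩
  exists_equiv := exists_equiv_dual_cZero
  continuous_coproduct := continuous_ellCoproduct (ellDiag_mem_of_isClosed isClosed_cZero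
    fun _ hx _ hy => ellDiag_ellTensor_mem_cZero hx hy)

/-! ### Hopf algebra preduals are subalgebras -/

theorem ellPairing_injective {x y : EllInfty S}
    (h : ∀ a : EllOne S, ellPairing S x a = ellPairing S y a) : x = y := by
  ext s
  rw [← ellPairing_ellDelta, h, ellPairing_ellDelta]

/-- The weak*-continuous functionals on `ℓ¹(S)` are those that `E` provides. -/
theorem mem_of_continuous_ellWeakStar {E : Submodule ℂ (EllInfty S)} {x : EllInfty S}
    (hx : Continuous[ellWeakStar E, inferInstance] fun a : EllOne S => ellPairing S x a) :
    x ∈ E := by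
  let L : EllInfty S →ₗ[ℂ] EllOne S →ₗ[ℂ] ℂ :=
    ContinuousLinearMap.coeLM ℂ ∘ₗ (ellPairing S).toLinearMap
  have hL : ∀ y a, L y a = ellPairing S y a := fun _ _ => rfl
  have hspan : L x ∈ Submodule.span ℂ (Set.range fun y : E => L y) := by
    refine (LinearMap.mem_span_iff_continuous _).mpr ?_
    have : ellWeakStar E = ⨅ y : E, TopologicalSpace.induced (fun a => L y a) inferInstance :=
      induced_to_pi _
    rw [← this]
    exact hx
  have hle : Submodule.span ℂ (Set.range fun y : E => L y) ≤ E.map L :=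
    Submodule.span_le.mpr (by rintro _ ⟨y, rfl⟩; exact ⟨y, y.2, rfl⟩)
  obtain ⟨y, hy, hyx⟩ := hle hspan
  have : y = x := ellPairing_injective fun a => by rw [← hL, ← hL, hyx]
  exact this ▸ hy

theorem IsHopfAlgebraPredual.ellDiag_ellTensor_mem [Mul S] {E : Submodule ℂ (EllInfty S)}
    (hE : IsHopfAlgebraPredual E) {x y : EllInfty S} (hx : x ∈ E) (hy : y ∈ E) :
    ellDiag (ellTensor x y) ∈ E := by
  have hz : ellTensor x y ∈ ellTensorSquare E :=
    Submodule.le_topologicalClosure _ (Submodule.subset_span ⟨x, hx, y, hy, rfl⟩)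
  have := @Continuous.comp _ _ _ (ellWeakStar E) (ellWeakStar (ellTensorSquare E)) _ _ _
    (continuous_ellWeakStar hz) hE.continuous_coproduct
  simp only [Function.comp_def, ellPairing_ellCoproduct] at this
  exact mem_of_continuous_ellWeakStar this

/-! ### Limits of points in the dual of a predual -/

theorem IsEllOnePredual.eq_zero [Mul S] {E : Submodule ℂ (EllInfty S)} (hE : IsEllOnePredual E)
    {a : EllOne S} (ha : ∀ x ∈ E, ellPairing S x a = 0) : a = 0 := by
  obtain ⟨e, he⟩ := hE.exists_equiv
  refine e.injective (ContinuousLinearMap.ext fun x => ?_)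
  rw [he, ha x x.2, map_zero, zero_apply]

theorem IsEllOnePredual.exists_apply_ne_zero [Mul S] {E : Submodule ℂ (EllInfty S)}
    (hE : IsEllOnePredual E) (s : S) : ∃ x ∈ E, x s ≠ 0 := by
  by_contra! h
  have := hE.eq_zero (a := ellDelta s) fun x hx => by rw [ellPairing_ellDelta, h x hx]
  simpa [this] using norm_ellDelta s

theorem IsEllOnePredual.eq_of_forall_apply_eq [Mul S] {E : Submodule ℂ (EllInfty S)}
    (hE : IsEllOnePredual E) {s t : S} (h : ∀ x ∈ E, x s = x t) : s = t := by
  by_contra hst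
  have := hE.eq_zero (a := ellDelta s - ellDelta t) fun x hx => by
    rw [map_sub, ellPairing_ellDelta, ellPairing_ellDelta, h x hx, sub_self]
  have := congrArg (fun a : EllOne S => a s) (sub_eq_zero.mp this)
  simp [ellDelta_apply_self, ellDelta_apply_of_ne hst] at this

/-- The Banach–Alaoglu theorem in terms of ultrafilters. -/
theorem StrongDual.exists_tendsto_of_norm_le_one {X ι : Type*} [NormedAddCommGroup X]
    [NormedSpace ℂ X] (f : ι → StrongDual ℂ X) (hf : ∀ i, ‖f i‖ ≤ 1) (p : Ultrafilter ι) :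
    ∃ φ : StrongDual ℂ X, ∀ x, Filter.Tendsto (fun i => f i x) p (𝓝 (φ x)) := by
  obtain ⟨φ, -, hφ⟩ := (WeakDual.isCompact_closedBall (𝕜 := ℂ) (E := X) 0 1).ultrafilter_le_nhds
    (p.map fun i => StrongDual.toWeakDual (f i)) (Filter.le_principal_iff.mpr
      (Ultrafilter.mem_map.mpr (Filter.Eventually.of_forall fun i =>
        mem_closedBall_zero_iff.mpr (hf i))))
  exact ⟨WeakDual.toStrongDual φ, fun x =>
    Filter.tendsto_map'_iff.mp ((WeakDual.eval_continuous x).continuousAt.tendsto.comp hφ)⟩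

/-- The point evaluations on a predual `E` converge along each ultrafilter to the functional of
some `a ∈ ℓ¹(S)`. -/
theorem IsEllOnePredual.exists_tendsto [Mul S] {E : Submodule ℂ (EllInfty S)}
    (hE : IsEllOnePredual E) (p : Ultrafilter S) :
    ∃ a : EllOne S, ∀ x ∈ E, Filter.Tendsto (fun s => x s) p (𝓝 (ellPairing S x a)) := by
  obtain ⟨e, he⟩ := hE.exists_equiv
  obtain ⟨φ, hφ⟩ := StrongDual.exists_tendsto_of_norm_le_one (fun s => e (ellDelta s))
    (fun s => ContinuousLinearMap.opNorm_le_bound _ zero_le_one fun x => by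
      rw [he, ellPairing_ellDelta, one_mul]
      exact ellInfty_norm_apply_le _ s) p
  refine ⟨e.symm φ, fun x hx => ?_⟩
  have h := he (e.symm φ) ⟨x, hx⟩
  rw [e.apply_symm_apply] at h
  rw [← h]
  exact (hφ ⟨x, hx⟩).congr fun s => (he _ _).trans (ellPairing_ellDelta _ _)

/-- An element of `ℓ¹(S)` which is multiplicative on a Hopf algebra predual `E` is a point mass, or
zero. -/
theorem IsHopfAlgebraPredual.eq_zero_or_exists_apply [Mul S] {E : Submodule ℂ (EllInfty S)}
    (hE : IsHopfAlgebraPredual E) {a : EllOne S}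
    (ha : ∀ x ∈ E, ∀ y ∈ E,
      ellPairing S (ellDiag (ellTensor x y)) a = ellPairing S x a * ellPairing S y a) :
    (∀ x ∈ E, ellPairing S x a = 0) ∨ ∃ t, ∀ x ∈ E, ellPairing S x a = x t := by
  rcases eq_or_ne a 0 with rfl | h0
  · exact Or.inl fun x _ => map_zero _
  obtain ⟨t, ht⟩ : ∃ t, a t ≠ 0 := by
    by_contra! h
    exact h0 (lp.ext (funext h))
  refine Or.inr ⟨t, fun y hy => ?_⟩
  -- Multiplicativity says that the pointwise product `y a` and `⟨y, a⟩ a` agree on `E`.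
  let b : EllOne S := ⟨fun s => y s * a s,
    memEllOne_of_summable_norm (summable_norm_ellInfty_mul y a)⟩
  have hb : b - ellPairing S y a • a = 0 := hE.eq_zero fun x hx => by
    have hxb : ellPairing S x b = ellPairing S (ellDiag (ellTensor x y)) a := by
      rw [ellPairing_apply, ellPairing_apply]
      exact tsum_congr fun s => (mul_assoc _ _ _).symm
    rw [map_sub, map_smul, hxb, ha x hx y hy, smul_eq_mul, mul_comm, sub_self]
  have hbt : y t * a t = ellPairing S y a * a t :=
    congrArg (fun c : EllOne S => c t) (sub_eq_zero.mp hb)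
  exact (mul_right_cancel₀ ht hbt).symm

theorem IsHopfAlgebraPredual.tendsto_zero_or_exists_tendsto [Mul S]
    {E : Submodule ℂ (EllInfty S)} (hE : IsHopfAlgebraPredual E) (p : Ultrafilter S) :
    (∀ x ∈ E, Filter.Tendsto (fun s => x s) p (𝓝 0)) ∨
      ∃ t, ∀ x ∈ E, Filter.Tendsto (fun s => x s) p (𝓝 (x t)) := by
  obtain ⟨a, ha⟩ := hE.exists_tendsto p
  have hmul : ∀ x ∈ E, ∀ y ∈ E,
      ellPairing S (ellDiag (ellTensor x y)) a = ellPairing S x a * ellPairing S y a :=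
    fun x hx y hy => tendsto_nhds_unique (ha _ (hE.ellDiag_ellTensor_mem hx hy))
      ((ha x hx).mul (ha y hy))
  rcases hE.eq_zero_or_exists_apply hmul with h | ⟨t, ht⟩
  · exact Or.inl fun x hx => h x hx ▸ ha x hx
  · exact Or.inr ⟨t, fun x hx => ht x hx ▸ ha x hx⟩

/-- The right ideals `uS` are closed for the topology of `S` which `E` induces: the limit
along an ultrafilter that contains `uS` is `u` times the limit of the ultrafilter of left quotients
by `u`. -/
theorem IsHopfAlgebraPredual.mem_range_mul_of_tendsto [Mul S] {E : Submodule ℂ (EllInfty S)}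
    (hE : IsHopfAlgebraPredual E) {p : Ultrafilter S} {t u : S}
    (ht : ∀ x ∈ E, Filter.Tendsto (fun s => x s) p (𝓝 (x t)))
    (hu : Set.range (fun s => u * s) ∈ p) : t ∈ Set.range fun s => u * s := by
  have : Nonempty S := ⟨u⟩
  let g : S → S := Function.invFun fun s => u * s
  have hg : ∀ᶠ s in p, u * g s = s := by
    filter_upwards [hu] with s hs using Function.invFun_eq hs
  have hlim : ∀ x ∈ E, ∃ y ∈ E, (∀ s, y s = x (u * s)) ∧
      Filter.Tendsto (fun s => y s) (p.map g) (𝓝 (x t)) := fun x hx => by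
    obtain ⟨y, hy, hyx⟩ := hE.right_mem (ellDelta u) x hx
    have hys : ∀ s, y s = x (u * s) := fun s => by
      rw [← ellPairing_ellDelta, hyx, ellPairing_ellConv_ellDelta]
    refine ⟨y, hy, hys, Filter.tendsto_map'_iff.mpr ((ht x hx).congr' ?_)⟩
    filter_upwards [hg] with s hs
    rw [Function.comp_apply, hys, hs]
  rcases hE.tendsto_zero_or_exists_tendsto (p.map g) with h | ⟨r, hr⟩
  · obtain ⟨x, hx, hxt⟩ := hE.exists_apply_ne_zero t
    obtain ⟨y, hy, -, hlim⟩ := hlim x hx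
    exact absurd (tendsto_nhds_unique hlim (h y hy)) hxt
  · refine ⟨r, hE.eq_of_forall_apply_eq fun x hx => ?_⟩
    obtain ⟨y, hy, hys, hlim⟩ := hlim x hx
    rw [← hys]
    exact tendsto_nhds_unique (hr y hy) hlim

/-! ### Uniqueness -/

/-- A predual contained in `c₀(S)` is equal to it: a functional on `c₀(S)` that vanishes on the
predual comes from `ℓ¹(S)`, hence is zero. -/
theorem IsEllOnePredual.eq_cZero_of_le [Mul S] {E : Submodule ℂ (EllInfty S)}
    (hE : IsEllOnePredual E) (hle : E ≤ cZero S) : E = cZero S := by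
  refine le_antisymm hle fun x hx => ?_
  by_contra hxE
  have : IsClosed (E : Set (EllInfty S)) := hE.isClosed
  obtain ⟨f, hf⟩ := SeparatingDual.exists_ne_zero (R := ℂ) (x := E.mkQ x)
    (fun h => hxE ((Submodule.Quotient.mk_eq_zero E).mp h))
  obtain ⟨a, ha⟩ := exists_ellPairing_eq_of_dual_cZero ((f.comp E.mkQL).comp (cZero S).subtypeL)
  have ha0 : a = 0 := hE.eq_zero fun y hy => by
    have h0 : E.mkQL y = 0 := (Submodule.Quotient.mk_eq_zero E).mpr hy
    have := ha ⟨y, hle hy⟩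
    simpa [h0] using this
  have := ha ⟨x, hx⟩
  rw [ha0, map_zero] at this
  exact hf this.symm

/-- The space `c₀(S)` is the only Hopf algebra predual if each `t ∈ S` lies in a finite set which is
the complement of finitely many of the sets `uS`. Such a set is open for the topology which `E`
induces on `S`, so that this topology is discrete. -/
theorem IsHopfAlgebraPredual.eq_cZero [Mul S] {E : Submodule ℂ (EllInfty S)}
    (hE : IsHopfAlgebraPredual E)
    (hS : ∀ t : S, ∃ F : Set S, F.Finite ∧ (∀ u ∈ F, t ∉ Set.range fun s => u * s) ∧
      (⋃ u ∈ F, Set.range fun s => u * s)ᶜ.Finite) : E = cZero S := by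
  refine hE.eq_cZero_of_le fun x hx => mem_cZero.mpr ?_
  refine (Filter.tendsto_iff_ultrafilter _ _ _).mpr fun p hp => ?_
  rcases hE.tendsto_zero_or_exists_tendsto p with h | ⟨t, ht⟩
  · exact h x hx
  obtain ⟨F, hF, hFt, hfin⟩ := hS t
  have hmem : (⋃ u ∈ F, Set.range fun s => u * s) ∈ p := hp (by simpa using hfin)
  obtain ⟨u, hu, hup⟩ := (Ultrafilter.finite_biUnion_mem_iff hF).mp hmem
  exact absurd (hE.mem_range_mul_of_tendsto ht hup) (hFt u hu)

/-! ### The two families of semigroups -/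

theorem exists_finite_compl_iUnion_range_mul_multiplicative {ι : Type*} [Finite ι]
    (t : Multiplicative (ι → ℕ)) :
    ∃ F : Set (Multiplicative (ι → ℕ)), F.Finite ∧ (∀ u ∈ F, t ∉ Set.range fun s => u * s) ∧
      (⋃ u ∈ F, Set.range fun s => u * s)ᶜ.Finite := by
  classical
  cases nonempty_fintype ι
  -- The complement of the translates by `(tᵢ + 1) eᵢ` is the box below `t`.
  refine ⟨Set.range fun i => .ofAdd (Pi.single i (t.toAdd i + 1)), Set.finite_range _, ?_, ?_⟩
  · rintro _ ⟨i, rfl⟩ ⟨s, hs⟩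
    have := congrArg (fun r : Multiplicative (ι → ℕ) => r.toAdd i) hs
    simp at this
    omega
  · refine ((Set.finite_Icc 0 t.toAdd).preimage
      Multiplicative.toAdd.injective.injOn).subset fun s hs => ⟨zero_le, fun i => ?_⟩
    by_contra! h
    refine hs (Set.mem_biUnion (Set.mem_range_self i)
      ⟨.ofAdd (s.toAdd - Pi.single i (t.toAdd i + 1)), ?_⟩)
    refine Multiplicative.toAdd.injective (add_tsub_cancel_of_le fun j => ?_)
    rcases eq_or_ne j i with rfl | hj
    · simpa using h
    · simp [hj]

theorem FreeSemigroup.mul_eq_mk {α : Type*} (u : FreeSemigroup α) (a : α) (l : List α) :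
    u * ⟨a, l⟩ = ⟨u.head, u.tail ++ a :: l⟩ := rfl

theorem FreeSemigroup.finite_length_le {α : Type*} [Finite α] (n : ℕ) :
    {s : FreeSemigroup α | s.length ≤ n}.Finite := by
  have h := List.finite_length_le α n
  refine (h.preimage (f := fun s : FreeSemigroup α => s.head :: s.tail) ?_).subset ?_
  · rintro ⟨a, l⟩ - ⟨b, m⟩ - h
    simpa using h
  · exact fun s hs => hs

instance FreeSemigroup.isCancelMul {α : Type*} : IsCancelMul (FreeSemigroup α) where
  mul_left_cancel u s t h := FreeSemigroup.toFreeMonoid_injective <| by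
    simpa using congrArg FreeSemigroup.toFreeMonoid h
  mul_right_cancel u s t h := FreeSemigroup.toFreeMonoid_injective <| by
    simpa using congrArg FreeSemigroup.toFreeMonoid h

theorem FreeSemigroup.exists_finite_compl_iUnion_range_mul {α : Type*} [Finite α]
    (t : FreeSemigroup α) :
    ∃ F : Set (FreeSemigroup α), F.Finite ∧ (∀ u ∈ F, t ∉ Set.range fun s => u * s) ∧
      (⋃ u ∈ F, Set.range fun s => u * s)ᶜ.Finite := by
  -- A word longer than `t` has a proper prefix of the length of `t`.
  refine ⟨{u | u.length = t.length}, (finite_length_le t.length).subset fun u hu => le_of_eq hu,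
    ?_, (finite_length_le t.length).subset fun s hs => ?_⟩
  · rintro u hu ⟨s, rfl⟩
    have : 0 < s.length := Nat.succ_pos _
    simp only [Set.mem_ofPred_eq, length_mul] at hu
    omega
  · by_contra h
    obtain ⟨a, l⟩ := s
    have hl : t.tail.length < l.length := by simpa [length] using h
    refine hs (Set.mem_biUnion (x := ⟨a, l.take t.tail.length⟩) ?_
      ⟨⟨l[t.tail.length], l.drop (t.tail.length + 1)⟩, ?_⟩)
    · simp [length, hl.le]
    · exact (FreeSemigroup.mul_eq_mk _ _ _).trans (by simp)

theorem mainTheorem2 (k : ℕ) (hk : 1 ≤ k) :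
    (IsHopfAlgebraPredual (cZero (Multiplicative (Fin k → ℕ))) ∧
      ∀ E : Submodule ℂ (EllInfty (Multiplicative (Fin k → ℕ))),
        IsHopfAlgebraPredual E → E = cZero (Multiplicative (Fin k → ℕ))) ∧
    (IsHopfAlgebraPredual (cZero (FreeSemigroup (Fin k))) ∧
      ∀ E : Submodule ℂ (EllInfty (FreeSemigroup (Fin k))),
        IsHopfAlgebraPredual E → E = cZero (FreeSemigroup (Fin k))) :=
  ⟨⟨isHopfAlgebraPredual_cZero, fun _ hE =>
      hE.eq_cZero exists_finite_compl_iUnion_range_mul_multiplicative⟩,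
    ⟨isHopfAlgebraPredual_cZero, fun _ hE =>
      hE.eq_cZero FreeSemigroup.exists_finite_compl_iUnion_range_mul⟩⟩
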